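/- An automorphism $g$ of $(\mathbb{Q},<)$ is called unboundedly increasing if $g(a)>a$ for all $a\in\mathbb{Q}$ and for all $a<b$ in $\mathbb{Q}$ there is $m\in\mathbb{N}$ with $g^m(a)>b$. The random tournament is the (unique up to isomorphism) countable tournament $(\mathbb{T},\to)$ such that for any two disjoint finite sets $A,B\subseteq\mathbb{T}$ there is $x\in\mathbb{T}$ with $x\to a$ for all $a\in A$ and $b\to x$ for all $b\in B$. (1) If $g$ is an unboundedly increasing automorphism of $(\mathbb{Q},<)$, then every element of $\mathrm{Aut}(\mathbb{Q},<)$ is a product of at most eight elements, each of which is a conjugate in $\mathrm{Aut}(\mathbb{Q},<)$ of $g$ or of $g^{-1}$. (2) If $g$ is an automorphism of the random tournament $(\mathbb{T},\to)$ such that $a\to g(a)$ for all $a\in\mathbb{T}$, then every element of $\mathrm{Aut}(\mathbb{T},\to)$ is a product of at most eight elements, each of which is a conjugate in $\mathrm{Aut}(\mathbb{T},\to)$ of $g$ or of $g^{-1}$. -/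

import Mathlib

/-- An automorphism `g` of a linear order is unboundedly increasing if it moves every point
strictly up and, for all `a < b`, some iterate of `g` takes `a` beyond `b`. -/
def UnboundedlyIncreasing {α : Type*} [LinearOrder α] (g : α ≃o α) : Prop :=
  (∀ a, a < g a) ∧ ∀ a b, a < b → ∃ m : ℕ, b < (g ^ m) a

/-- `r` (read `r a b` as `a → b`) is a tournament: it is irreflexive, and between any two
distinct points there is exactly one arrow. -/
structure IsTournament {T : Type*} (r : T → T → Prop) : Prop where
  irrefl : ∀ a, ¬ r a a
  asymm : ∀ a b, r a b → ¬ r b a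
  total : ∀ a b, a ≠ b → r a b ∨ r b a

/-- `(T, r)` is the random tournament: the countable tournament, unique up to isomorphism, in which
for all disjoint finite sets `A`, `B` there is a point `x` with `x → a` for all `a ∈ A` and
`b → x` for all `b ∈ B`. -/
structure IsRandomTournament {T : Type*} (r : T → T → Prop) : Prop extends IsTournament r where
  countable : Countable T
  extension : ∀ A B : Finset T, Disjoint A B → ∃ x, (∀ a ∈ A, r x a) ∧ ∀ b ∈ B, r b x

/-- `h` is a product of at most `n` factors, each a conjugate of `g` or of `g⁻¹`. -/
def IsProdOfConjugates {G : Type*} [Group G] (n : ℕ) (g h : G) : Prop :=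
  ∃ l : List G, l.length ≤ n ∧ (∀ x ∈ l, IsConj g x ∨ IsConj g⁻¹ x) ∧ l.prod = h

/-!
For a doubly homogeneous order such as `ℚ`, any two unboundedly increasing automorphisms are
conjugate: match a fundamental interval `[a, f a)` of one with a fundamental interval of the other
and extend equivariantly. Given `h`, the automorphism `f = max (h g) g` is unboundedly increasing,
and so is `h⁻¹ f = max (g, h⁻¹ g)`; hence `h = f (h⁻¹ f)⁻¹` is a product of two conjugates of `g`
and `g⁻¹`.

For the random tournament it is enough that `g` has no fixed points. If `b` is built generically
from finite pieces, then `u = g · b⁻¹ g b` has only infinite orbits and realizes every finite type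
by a point `y` with `y → u y` off any finitely many orbits. Any automorphism `h` is then a product
of three conjugates of `u`: approximate the three conjugators by finite partial isomorphisms, and
each time a value of one of the three conjugates is decided, decide values of the other two so that
the three compose to `h` there. The partial isomorphisms meet each `u`-orbit in an interval, so
such a triangle has two free corners and one edge that can be inserted by the genericity of `u`.
-/

namespace IsProdOfConjugates

variable {G : Type*} [Group G] {m n : ℕ} {g h k : G}

theorem mono (hmn : m ≤ n) : IsProdOfConjugates m g h → IsProdOfConjugates n g h :=
  fun ⟨l, hl, hconj, hprod⟩ => ⟨l, hl.trans hmn, hconj, hprod⟩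

theorem of_isConj (h : IsConj g k) : IsProdOfConjugates 1 g k :=
  ⟨[k], le_rfl, by simpa only [List.forall_mem_singleton] using Or.inl h, List.prod_singleton⟩

theorem inv_of_isConj (h : IsConj g k) : IsProdOfConjugates 1 g k⁻¹ := by
  obtain ⟨c, rfl⟩ := isConj_iff.1 h
  have : IsConj g⁻¹ (c * g * c⁻¹)⁻¹ := isConj_iff.2 ⟨c, conj_inv.symm⟩
  exact ⟨[_], le_rfl, by simpa only [List.forall_mem_singleton] using Or.inr this,
    List.prod_singleton⟩

theorem mul : IsProdOfConjugates m g h → IsProdOfConjugates n g k →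
    IsProdOfConjugates (m + n) g (h * k)
  | ⟨l, hl, hconj, hprod⟩, ⟨l', hl', hconj', hprod'⟩ =>
    ⟨l ++ l', by simpa using add_le_add hl hl',
      fun x hx => (List.mem_append.1 hx).elim (hconj x) (hconj' x),
      by rw [List.prod_append, hprod, hprod']⟩

theorem congr_isConj (hgh : IsProdOfConjugates n g h) (hhk : IsConj h k) :
    IsProdOfConjugates n g k := by
  obtain ⟨l, hl, hconj, rfl⟩ := hgh
  obtain ⟨c, rfl⟩ := isConj_iff.1 hhk
  refine ⟨l.map (MulAut.conj c), by simpa using hl, fun y hy => ?_, by simp [← map_list_prod]⟩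
  obtain ⟨x, hx, rfl⟩ := List.mem_map.1 hy
  have hxy : IsConj x (MulAut.conj c x) := isConj_iff.2 ⟨c, rfl⟩
  exact (hconj x hx).imp (·.trans hxy) (·.trans hxy)

end IsProdOfConjugates

/-! ### Doubly homogeneous linear orders -/

/-- Any pair `a < b` can be mapped to any other pair `c < d` by an automorphism. -/
def IsDoublyHomogeneous (α : Type*) [LinearOrder α] : Prop :=
  ∀ ⦃a b c d : α⦄, a < b → c < d → ∃ φ : α ≃o α, φ a = c ∧ φ b = d

theorem isDoublyHomogeneous_of_field (K : Type*) [Field K] [LinearOrder K]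
    [IsStrictOrderedRing K] : IsDoublyHomogeneous K := fun a b c d hab hcd => by
  have hab' : 0 < b - a := sub_pos.2 hab
  let affine := ((OrderIso.addRight (-a)).trans
    (OrderIso.mulRight₀ _ (div_pos (sub_pos.2 hcd) hab'))).trans (OrderIso.addRight c)
  have affine_apply (x : K) : affine x = (x - a) * ((d - c) / (b - a)) + c := by
    simp [affine, sub_eq_add_neg]
  exact ⟨affine, by simp [affine_apply], by simp [affine_apply, mul_div_cancel₀ _ hab'.ne']⟩

/-- The pointwise maximum of two automorphisms; its inverse is the pointwise minimum of their
inverses. -/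
def autMax {α : Type*} [LinearOrder α] (f g : α ≃o α) : α ≃o α where
  toFun x := max (f x) (g x)
  invFun x := min (f.symm x) (g.symm x)
  left_inv x := by
    rcases le_total (f x) (g x) with h | h
    · simpa [max_eq_right h] using f.le_symm_apply.2 h
    · simpa [max_eq_left h] using g.le_symm_apply.2 h
  right_inv x := by
    rcases le_total (f.symm x) (g.symm x) with h | h
    · simpa [min_eq_left h] using g.le_symm_apply.1 h
    · simpa [min_eq_right h] using f.le_symm_apply.1 h
  map_rel_iff' :=
    StrictMono.le_iff_le fun _ _ hxy => max_lt_max (f.strictMono hxy) (g.strictMono hxy)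

namespace UnboundedlyIncreasing

variable {α : Type*} [LinearOrder α] {f g : α ≃o α}

theorem mono (hg : UnboundedlyIncreasing g) (hgf : ∀ x, g x ≤ f x) : UnboundedlyIncreasing f := by
  have pow_le (n : ℕ) (x : α) : (g ^ n) x ≤ (f ^ n) x := by
    induction n generalizing x with
    | zero => rfl
    | succ n ih =>
      rw [pow_succ, pow_succ]
      exact (ih (g x)).trans ((f ^ n).monotone (hgf x))
  refine ⟨fun x => (hg.1 x).trans_le (hgf x), fun a b hab => ?_⟩
  obtain ⟨m, hm⟩ := hg.2 a b hab
  exact ⟨m, hm.trans_le (pow_le m a)⟩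

theorem strictMono_zpow (hg : UnboundedlyIncreasing g) (a : α) :
    StrictMono fun n : ℤ => (g ^ n) a :=
  strictMono_int_of_lt_succ fun n => by
    rw [add_comm, zpow_add, zpow_one]
    exact hg.1 _

theorem exists_lt_zpow (hg : UnboundedlyIncreasing g) (a b : α) : ∃ n : ℤ, b < (g ^ n) a := by
  rcases le_or_gt b a with hba | hab
  · exact ⟨1, by simpa using hba.trans_lt (hg.1 a)⟩
  · exact (hg.2 a b hab).imp' Int.ofNat fun m hm => by simpa using hm

theorem exists_zpow_le (hg : UnboundedlyIncreasing g) (a b : α) : ∃ n : ℤ, (g ^ n) a ≤ b := by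
  obtain ⟨n, hn⟩ := hg.exists_lt_zpow b a
  refine ⟨-n, ?_⟩
  have := (g ^ (-n)).monotone hn.le
  rwa [← RelIso.mul_apply, ← zpow_add, neg_add_cancel, zpow_zero] at this

theorem existsUnique_zpow_le_lt (hg : UnboundedlyIncreasing g) (a b : α) :
    ∃! n : ℤ, (g ^ n) a ≤ b ∧ b < (g ^ (n + 1)) a := by
  obtain ⟨k, hk⟩ := hg.exists_lt_zpow a b
  have bounded (n : ℤ) (hn : (g ^ n) a ≤ b) : n ≤ k :=
    ((hg.strictMono_zpow a).lt_iff_lt.1 (hn.trans_lt hk)).le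
  obtain ⟨n, hn, hmax⟩ := Int.exists_greatest_of_bdd ⟨k, bounded⟩ (hg.exists_zpow_le a b)
  have hlt : b < (g ^ (n + 1)) a := not_le.1 fun h => (hmax _ h).not_gt (Int.lt_succ n)
  refine ⟨n, ⟨hn, hlt⟩, fun m ⟨hm, hm'⟩ => (hmax m hm).antisymm ?_⟩
  exact Int.lt_add_one_iff.1 ((hg.strictMono_zpow a).lt_iff_lt.1 (hn.trans_lt hm'))

/-- On the `n`-th fundamental interval `[f ^ n a, f ^ (n + 1) a)` of `f`, the transport of the
automorphism `φ` of the `0`-th one to the `n`-th fundamental interval of `g`. -/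
def transport (f g φ : α ≃o α) (n : ℤ) : α ≃o α := g ^ n * φ * (f ^ n)⁻¹

theorem transport_zpow_apply {φ : α ≃o α} {a b : α} (hφ : φ a = b) (n : ℤ) :
    transport f g φ n ((f ^ n) a) = (g ^ n) b := by
  simp only [transport, RelIso.mul_apply, RelIso.inv_apply_self, hφ]

theorem transport_zpow_succ_apply {φ : α ≃o α} {a b : α} (hφ : φ (f a) = g b) (n : ℤ) :
    transport f g φ n ((f ^ (n + 1)) a) = (g ^ (n + 1)) b := by
  simp only [transport, zpow_add_one, RelIso.mul_apply, RelIso.inv_apply_self, hφ]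

theorem transport_succ_mul (f g φ : α ≃o α) (n : ℤ) :
    transport f g φ (n + 1) * f = g * transport f g φ n := by
  simp only [transport]
  group

theorem exists_eq_transport (hf : UnboundedlyIncreasing f) (hg : UnboundedlyIncreasing g)
    {φ : α ≃o α} {a b : α} (hφ : φ a = b) (hφf : φ (f a) = g b) :
    ∃ Φ : α ≃o α, ∀ n x, (f ^ n) a ≤ x → x < (f ^ (n + 1)) a → Φ x = transport f g φ n x := by
  choose level hlevel level_unique using hf.existsUnique_zpow_le_lt a
  have le_transport {n : ℤ} {x : α} (hx : (f ^ n) a ≤ x) : (g ^ n) b ≤ transport f g φ n x := by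
    rwa [← transport_zpow_apply hφ, OrderIso.le_iff_le]
  have transport_lt {n : ℤ} {x : α} (hx : x < (f ^ (n + 1)) a) :
      transport f g φ n x < (g ^ (n + 1)) b := by
    rwa [← transport_zpow_succ_apply hφf, OrderIso.lt_iff_lt]
  have hmono : StrictMono fun x => transport f g φ (level x) x := by
    intro x y hxy
    have hlt : level x < level y + 1 := (hf.strictMono_zpow a).lt_iff_lt.1
      ((hlevel x).1.trans_lt (hxy.trans (hlevel y).2))
    rcases (Int.lt_add_one_iff.1 hlt).eq_or_lt with heq | hlt
    · simpa only [heq] using (transport f g φ (level y)).strictMono hxy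
    · exact (transport_lt (hlevel x).2).trans_le
        (((hg.strictMono_zpow b).monotone hlt).trans (le_transport (hlevel y).1))
  have hsurj : Function.Surjective fun x => transport f g φ (level x) x := by
    intro y
    obtain ⟨n, ⟨hn, hn'⟩, -⟩ := hg.existsUnique_zpow_le_lt b y
    refine ⟨(transport f g φ n).symm y, ?_⟩
    have : n = level ((transport f g φ n).symm y) := level_unique _ _
      ⟨by rwa [OrderIso.le_symm_apply, transport_zpow_apply hφ],
        by rwa [OrderIso.symm_apply_lt, transport_zpow_succ_apply hφf]⟩
    simp only [← this, OrderIso.apply_symm_apply]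
  refine ⟨hmono.orderIsoOfSurjective _ hsurj, fun n x hx hx' => ?_⟩
  rw [level_unique x n ⟨hx, hx'⟩]
  rfl

theorem isConj (hα : IsDoublyHomogeneous α) (hf : UnboundedlyIncreasing f)
    (hg : UnboundedlyIncreasing g) : IsConj f g := by
  rcases isEmpty_or_nonempty α with _ | ⟨⟨a⟩⟩
  · rw [Subsingleton.elim f g]
  obtain ⟨φ, hφ, hφf⟩ := hα (hf.1 a) (hg.1 a)
  obtain ⟨Φ, hΦ⟩ := hf.exists_eq_transport hg hφ hφf
  refine isConj_iff.2 ⟨Φ, mul_inv_eq_iff_eq_mul.2 (RelIso.ext fun x => ?_)⟩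
  obtain ⟨n, ⟨hn, hn'⟩, -⟩ := hf.existsUnique_zpow_le_lt a x
  have hΦf : Φ (f x) = transport f g φ (n + 1) (f x) := hΦ _ _
    (by rwa [add_comm, zpow_one_add, RelIso.mul_apply, OrderIso.le_iff_le])
    (by rwa [add_comm (n + 1), zpow_one_add, RelIso.mul_apply, OrderIso.lt_iff_lt])
  rw [RelIso.mul_apply, RelIso.mul_apply, hΦ n x hn hn', hΦf, ← RelIso.mul_apply,
    ← RelIso.mul_apply, transport_succ_mul]

/-- Taking `f = max (h g) g`, both `f` and `h⁻¹ f = max (g, h⁻¹ g)` lie above `g`. -/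
theorem isProdOfConjugates_two (hα : IsDoublyHomogeneous α) (hg : UnboundedlyIncreasing g)
    (h : α ≃o α) : IsProdOfConjugates 2 g h := by
  have hf : UnboundedlyIncreasing (autMax (h * g) g) := hg.mono fun _ => le_max_right _ _
  have hhf : UnboundedlyIncreasing (h⁻¹ * autMax (h * g) g) := hg.mono fun x =>
    h.le_symm_apply.2 (le_max_left (h (g x)) (g x))
  have hprod : autMax (h * g) g * (h⁻¹ * autMax (h * g) g)⁻¹ = h := by group
  rw [← hprod]
  exact (IsProdOfConjugates.of_isConj (hg.isConj hα hf)).mul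
    (.inv_of_isConj (hg.isConj hα hhf))

end UnboundedlyIncreasing

/-! ### Finite partial isomorphisms of tournaments -/

/-- `y` realizes the type over `A ∪ B` of a point with arrows to all of `A` and from all of `B`. -/
def Realizes {T : Type*} (r : T → T → Prop) (A B : Set T) (y : T) : Prop :=
  (∀ a ∈ A, r y a) ∧ ∀ b ∈ B, r b y

theorem Realizes.map {T : Type*} {r : T → T → Prop} (u : r ≃r r) {A B : Set T} {y : T}
    (hy : Realizes r (u ⁻¹' A) (u ⁻¹' B) y) : Realizes r A B (u y) := by
  refine ⟨fun a ha => ?_, fun b hb => ?_⟩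
  · obtain ⟨a, rfl⟩ := u.surjective a
    exact u.map_rel_iff.2 (hy.1 a ha)
  · obtain ⟨b, rfl⟩ := u.surjective b
    exact u.map_rel_iff.2 (hy.2 b hb)

theorem Realizes.subset {T : Type*} {r : T → T → Prop} {A A' B B' : Set T} {y : T}
    (hy : Realizes r A B y) (hA : A' ⊆ A) (hB : B' ⊆ B) : Realizes r A' B' y :=
  ⟨fun a ha => hy.1 a (hA ha), fun b hb => hy.2 b (hB hb)⟩

theorem IsTournament.disjoint_out_in {T : Type*} {r : T → T → Prop} (hr : IsTournament r) (x : T) :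
    Disjoint {a | r x a} {a | r a x} :=
  Set.disjoint_left.2 fun _ => hr.asymm _ _

theorem IsRandomTournament.exists_realizes_notMem {T : Type*} {r : T → T → Prop}
    (hr : IsRandomTournament r) {A B F : Set T} (hA : A.Finite) (hB : B.Finite) (hF : F.Finite)
    (hAB : Disjoint A B) : ∃ x ∉ F, Realizes r A B x := by
  have hBF : (B ∪ F \ A).Finite := hB.union hF.sdiff
  have hdisj : Disjoint hA.toFinset hBF.toFinset :=
    Set.Finite.disjoint_toFinset.2 (hAB.union_right Set.disjoint_sdiff_right)
  obtain ⟨x, hxA, hxB⟩ := hr.extension _ _ hdisj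
  simp only [Set.Finite.mem_toFinset] at hxA hxB
  refine ⟨x, fun hxF => ?_, hxA, fun b hb => hxB b (Or.inl hb)⟩
  by_cases hx : x ∈ A
  · exact hr.irrefl x (hxA x hx)
  · exact hr.irrefl x (hxB x (Or.inr ⟨hxF, hx⟩))

theorem dom_insert {α β : Type*} {S : SetRel α β} {x : α} {y : β} :
    SetRel.dom (insert (x, y) S) = insert x S.dom := by
  ext a
  simp [exists_or]

theorem cod_insert {α β : Type*} {S : SetRel α β} {x : α} {y : β} :
    SetRel.cod (insert (x, y) S) = insert y S.cod := by
  ext b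
  simp [exists_or]

/-- `S` preserves and reflects the relations. Between tournaments this already makes `S` the graph
of an injective partial function. -/
structure PartIso {α β : Type*} (r : α → α → Prop) (s : β → β → Prop) (S : SetRel α β) : Prop where
  rel_iff : ∀ {x x' y y'}, (x, y) ∈ S → (x', y') ∈ S → (r x x' ↔ s y y')

namespace PartIso

variable {α β : Type*} {r : α → α → Prop} {s : β → β → Prop} {S : SetRel α β}
  {x x' : α} {y y' : β}

theorem inv (hS : PartIso r s S) : PartIso s r S.inv :=
  ⟨fun hp hq => (hS.rel_iff hp hq).symm⟩

theorem right_unique (hS : PartIso r s S) (hr : IsTournament r) (hs : IsTournament s)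
    (hy : (x, y) ∈ S) (hy' : (x, y') ∈ S) : y = y' := by
  by_contra hne
  rcases hs.total _ _ hne with hyy' | hyy'
  · exact hr.irrefl x ((hS.rel_iff hy hy').2 hyy')
  · exact hr.irrefl x ((hS.rel_iff hy' hy).2 hyy')

theorem left_unique (hS : PartIso r s S) (hr : IsTournament r) (hs : IsTournament s)
    (hx : (x, y) ∈ S) (hx' : (x', y) ∈ S) : x = x' :=
  hS.inv.right_unique hs hr hx hx'

theorem disjoint_image (hS : PartIso r s S) (hr : IsTournament r) (hs : IsTournament s)
    {A B : Set α} (hAB : Disjoint A B) : Disjoint (S.image A) (S.image B) := by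
  rw [Set.disjoint_left]
  rintro y ⟨a, ha, hay⟩ ⟨b, hb, hby⟩
  exact Set.disjoint_left.1 hAB ha (hS.left_unique hr hs hay hby ▸ hb)

theorem insert_right (hS : PartIso r s S) (hr : IsTournament r) (hs : IsTournament s)
    (hx : x ∉ S.dom) (hy : Realizes s (S.image {a | r x a}) (S.image {a | r a x}) y) :
    PartIso r s (insert (x, y) S) := by
  have hpos {a b} (hab : (a, b) ∈ S) : r x a ∨ r a x := hr.total _ _ fun h => hx (h ▸ ⟨b, hab⟩)
  have hout {a b} (hab : (a, b) ∈ S) : r x a ↔ s y b :=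
    ⟨fun hxa => hy.1 b ⟨a, hxa, hab⟩, fun hyb => (hpos hab).resolve_right fun hax =>
      hs.asymm _ _ hyb (hy.2 b ⟨a, hax, hab⟩)⟩
  have hin {a b} (hab : (a, b) ∈ S) : r a x ↔ s b y :=
    ⟨fun hax => hy.2 b ⟨a, hax, hab⟩, fun hby => (hpos hab).resolve_left fun hxa =>
      hs.asymm _ _ hby (hy.1 b ⟨a, hxa, hab⟩)⟩
  refine ⟨?_⟩
  rintro a a' b b' (hab | hab) (hab' | hab')
  · obtain ⟨⟨rfl, rfl⟩, rfl, rfl⟩ := And.intro (Prod.mk.inj hab) (Prod.mk.inj hab')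
    exact iff_of_false (hr.irrefl _) (hs.irrefl _)
  · obtain ⟨rfl, rfl⟩ := Prod.mk.inj hab
    exact hout hab'
  · obtain ⟨rfl, rfl⟩ := Prod.mk.inj hab'
    exact hin hab
  · exact hS.rel_iff hab hab'

theorem insert_left (hS : PartIso r s S) (hr : IsTournament r) (hs : IsTournament s)
    (hy : y ∉ S.cod) (hx : Realizes r (S.preimage {b | s y b}) (S.preimage {b | s b y}) x) :
    PartIso r s (insert (x, y) S) := by
  have hinv := (hS.inv.insert_right hs hr hy hx).inv
  have hinsert : (insert (y, x) S.inv).inv = insert (x, y) S := by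
    ext ⟨a, b⟩
    simp [and_comm]
  rwa [hinsert] at hinv

end PartIso

/-- A finite partial isomorphism. -/
structure FinPartIso {α β : Type*} (r : α → α → Prop) (s : β → β → Prop) (S : SetRel α β) : Prop
    extends PartIso r s S where
  finite : S.Finite

namespace FinPartIso

variable {α β : Type*} {r : α → α → Prop} {s : β → β → Prop} {S : SetRel α β}

theorem empty : FinPartIso r s ∅ where
  rel_iff h := h.elim
  finite := Set.finite_empty

theorem inv (hS : FinPartIso r s S) : FinPartIso s r S.inv where
  toPartIso := hS.toPartIso.inv
  finite := hS.finite.preimage Prod.swap_injective.injOn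

theorem finite_cod (hS : FinPartIso r s S) : S.cod.Finite :=
  (hS.finite.image Prod.snd).subset fun _ ⟨_, hab⟩ => ⟨_, hab, rfl⟩

theorem finite_dom (hS : FinPartIso r s S) : S.dom.Finite :=
  hS.inv.finite_cod

theorem finite_image (hS : FinPartIso r s S) (A : Set α) : (S.image A).Finite :=
  hS.finite_cod.subset fun _ ⟨_, _, hab⟩ => ⟨_, hab⟩

theorem exists_insert_right (hS : FinPartIso r s S) (hr : IsTournament r)
    (hs : IsRandomTournament s) {x : α} (hx : x ∉ S.dom) {F : Set β} (hF : F.Finite) :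
    ∃ y ∉ F, FinPartIso r s (insert (x, y) S) := by
  obtain ⟨y, hyF, hy⟩ := hs.exists_realizes_notMem (hS.finite_image _) (hS.finite_image _) hF
    (hS.disjoint_image hr hs.toIsTournament (hr.disjoint_out_in x))
  exact ⟨y, hyF, hS.toPartIso.insert_right hr hs.toIsTournament hx hy, hS.finite.insert _⟩

theorem exists_insert_left (hS : FinPartIso r s S) (hr : IsRandomTournament r)
    (hs : IsTournament s) {y : β} (hy : y ∉ S.cod) {F C : Set α} (hF : F.Finite) (hC : C.Finite)
    (hCS : Disjoint C S.dom) :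
    ∃ x ∉ F, (∀ c ∈ C, r c x) ∧ FinPartIso r s (insert (x, y) S) := by
  have hdom : S.preimage {b | s y b} ⊆ S.dom := fun _ ⟨b, _, hab⟩ => ⟨b, hab⟩
  have hdisj : Disjoint (S.preimage {b | s y b}) (S.preimage {b | s b y} ∪ C) :=
    (hS.toPartIso.inv.disjoint_image hs hr.toIsTournament (hs.disjoint_out_in y)).union_right
      (hCS.symm.mono_left hdom)
  obtain ⟨x, hxF, hx⟩ := hr.exists_realizes_notMem (hS.inv.finite_image _)
    ((hS.inv.finite_image _).union hC) hF hdisj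
  exact ⟨x, hxF, fun c hc => hx.2 c (Or.inr hc),
    hS.toPartIso.insert_left hr.toIsTournament hs hy
      (hx.subset subset_rfl Set.subset_union_left), hS.finite.insert _⟩

end FinPartIso

/-! ### Partial conjugates of an automorphism -/

/-- `f` has no periodic points; the exponent of the excluded period is `n + 1`. -/
def Aperiodic {β : Type*} (f : β → β) : Prop :=
  ∀ y n, f^[n] (f y) ≠ y

/-- `y` lies on none of the `f`-orbits of points of `F`. -/
def OffOrbits {β : Type*} (f : β → β) (F : Set β) (y : β) : Prop :=
  ∀ z ∈ F, ∀ n, f^[n] y ≠ z ∧ f^[n] z ≠ y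

/-- Each orbit of `f` meets `R` in an interval. -/
def OrbitConvex {β : Type*} (f : β → β) (R : Set β) : Prop :=
  ∀ y ∈ R, f y ∉ R → ∀ n, f^[n] (f y) ∉ R

theorem OffOrbits.notMem {β : Type*} {f : β → β} {F : Set β} {y : β} (hy : OffOrbits f F y) :
    y ∉ F :=
  fun h => (hy y h 0).1 rfl

theorem OffOrbits.apply_notMem {β : Type*} {f : β → β} {F : Set β} {y : β}
    (hy : OffOrbits f F y) : f y ∉ F :=
  fun h => (hy _ h 1).1 rfl

namespace OrbitConvex

variable {β : Type*} {f : β → β} {R : Set β} {y : β}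

theorem insert_next (hR : OrbitConvex f R) (hf : Aperiodic f) (hinj : Function.Injective f)
    (hy : y ∈ R) (hfy : f y ∉ R) : OrbitConvex f (insert (f y) R) := by
  rintro z (rfl | hz) hfz n
  · exact not_or.2 ⟨hf _ n, hR y hy hfy (n + 1)⟩
  · obtain ⟨hne, hfz⟩ := not_or.1 hfz
    refine not_or.2 ⟨fun h => ?_, hR z hz hfz n⟩
    rw [← Function.iterate_succ_apply, Function.iterate_succ_apply'] at h
    have hzy : f^[n] z = y := hinj h
    cases n with
    | zero => exact hne (congrArg f hzy)
    | succ n => exact hR z hz hfz n (hzy ▸ hy)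

theorem insert_prev (hR : OrbitConvex f R) (hfy : f y ∈ R) : OrbitConvex f (insert y R) := by
  rintro z (rfl | hz) hfz n
  · exact (hfz (Or.inr hfy)).elim
  · obtain ⟨-, hfz⟩ := not_or.1 hfz
    refine not_or.2 ⟨fun h => hR z hz hfz (n + 1) ?_, hR z hz hfz n⟩
    rwa [Function.iterate_succ_apply', h]

theorem insert_offOrbits (hR : OrbitConvex f R) (hf : Aperiodic f) (hy : OffOrbits f R y) :
    OrbitConvex f (insert y R) := by
  rintro z (rfl | hz) hfz n
  · exact not_or.2 ⟨hf _ n, fun h => (hy _ h (n + 1)).1 rfl⟩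
  · exact not_or.2 ⟨(hy z hz (n + 1)).2, hR z hz (not_or.1 hfz).2 n⟩

end OrbitConvex

/-- `u` has only infinite orbits, and every type over a finite set is realized, outside finitely
many given orbits, by a point `y` with `y → u y`. -/
structure FreelyMoving {β : Type*} {s : β → β → Prop} (u : s ≃r s) : Prop where
  aperiodic : Aperiodic u
  dense : ∀ A B F : Set β, A.Finite → B.Finite → F.Finite → Disjoint A B →
    ∃ y, Realizes s A B y ∧ s y (u y) ∧ OffOrbits u F y

/-- The pairs `p ↦ q` forced in the conjugate `a⁻¹ u a` for every map `a` extending `S`. -/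
def edges {α β : Type*} (u : β → β) (S : SetRel α β) : SetRel α α :=
  {p | ∃ y, (p.1, y) ∈ S ∧ (p.2, u y) ∈ S}

section edges

variable {α β : Type*} {u : β → β} {S S' : SetRel α β} {p q x : α} {y : β}

theorem edges_mono (h : S ⊆ S') : edges u S ⊆ edges u S' :=
  fun _ ⟨y, hp, hq⟩ => ⟨y, h hp, h hq⟩

theorem mem_edges_insert (hy : u y ≠ y) (hpq : (p, q) ∈ edges u (insert (x, y) S)) :
    (p, q) ∈ edges u S ∨ (p = x ∧ (q, u y) ∈ S) ∨ (q = x ∧ ∃ z, u z = y ∧ (p, z) ∈ S) := by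
  obtain ⟨z, hp | hp, hq | hq⟩ := hpq
  · obtain ⟨⟨rfl, rfl⟩, -, h⟩ := And.intro (Prod.mk.inj hp) (Prod.mk.inj hq)
    exact (hy h).elim
  · obtain ⟨rfl, rfl⟩ := Prod.mk.inj hp
    exact Or.inr (Or.inl ⟨rfl, hq⟩)
  · obtain ⟨rfl, hz⟩ := Prod.mk.inj hq
    exact Or.inr (Or.inr ⟨rfl, z, hz, hp⟩)
  · exact Or.inl ⟨z, hp, hq⟩

theorem edges_insert_subset_of_fresh (hy : u y ≠ y) (hnext : u y ∉ S.cod)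
    (hprev : ∀ z ∈ S.cod, u z ≠ y) : edges u (insert (x, y) S) ⊆ edges u S := by
  rintro ⟨p, q⟩ hpq
  rcases mem_edges_insert hy hpq with h | ⟨-, hq⟩ | ⟨-, z, hz, hp⟩
  · exact h
  · exact (hnext ⟨q, hq⟩).elim
  · exact (hprev z ⟨p, hp⟩ hz).elim

end edges

theorem partIso_edges {α β : Type*} {r : α → α → Prop} {s : β → β → Prop} {S : SetRel α β}
    (hS : PartIso r s S) (u : s ≃r s) : PartIso r r (edges u S) :=
  ⟨fun ⟨_, hx, hy⟩ ⟨_, hx', hy'⟩ =>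
    (hS.rel_iff hx hx').trans (u.map_rel_iff.symm.trans (hS.rel_iff hy hy').symm)⟩

theorem conj_apply_of_mem_edges {α β : Type*} {r : α → α → Prop} {s : β → β → Prop}
    {S : SetRel α β} {u : s ≃r s} {a : r ≃r s} (ha : ∀ x y, (x, y) ∈ S → a x = y) {p q : α}
    (hpq : (p, q) ∈ edges u S) : a.symm (u (a p)) = q := by
  obtain ⟨y, hp, hq⟩ := hpq
  rw [ha p y hp, ← ha q _ hq, a.symm_apply_apply]

/-- A finite partial isomorphism whose range meets each `u`-orbit in an interval. -/
structure ConvexPartIso {α β : Type*} (r : α → α → Prop) {s : β → β → Prop} (u : s ≃r s)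
    (S : SetRel α β) : Prop extends FinPartIso r s S where
  convex : OrbitConvex u S.cod

namespace ConvexPartIso

variable {α β : Type*} {r : α → α → Prop} {s : β → β → Prop} {u : s ≃r s} {S : SetRel α β}
  {p q w x x' : α} {y v : β}

theorem empty : ConvexPartIso r u ∅ where
  toFinPartIso := .empty
  convex := by simp [OrbitConvex]

theorem insert_next (hS : ConvexPartIso r u S) (hu : Aperiodic u) (hy : y ∈ S.cod)
    (huy : u y ∉ S.cod) (hw : PartIso r s (insert (w, u y) S)) :
    ConvexPartIso r u (insert (w, u y) S) where
  toPartIso := hw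
  finite := hS.finite.insert _
  convex := cod_insert ▸ hS.convex.insert_next hu u.injective hy huy

theorem insert_prev (hS : ConvexPartIso r u S) (hv : u v ∈ S.cod)
    (hw : PartIso r s (insert (w, v) S)) : ConvexPartIso r u (insert (w, v) S) where
  toPartIso := hw
  finite := hS.finite.insert _
  convex := cod_insert ▸ hS.convex.insert_prev hv

theorem insert_offOrbits (hS : ConvexPartIso r u S) (hu : Aperiodic u)
    (hy : OffOrbits u S.cod y) (hx : PartIso r s (insert (x, y) S)) :
    ConvexPartIso r u (insert (x, y) S) where
  toPartIso := hx
  finite := hS.finite.insert _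
  convex := cod_insert ▸ hS.convex.insert_offOrbits hu hy

theorem edges_insert_next_subset (hS : ConvexPartIso r u S) (hu : Aperiodic u)
    (hr : IsTournament r) (hs : IsTournament s) (hp : (p, y) ∈ S) (huy : u y ∉ S.cod) :
    edges u (insert (w, u y) S) ⊆ insert (p, w) (edges u S) := by
  rintro ⟨p', q'⟩ hpq
  rcases mem_edges_insert (hu _ 0) hpq with h | ⟨-, hq⟩ | ⟨rfl, z, hz, hp'⟩
  · exact Or.inr h
  · exact (hS.convex y ⟨p, hp⟩ huy 1 ⟨q', hq⟩).elim
  · obtain rfl := u.injective hz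
    exact Or.inl (by rw [hS.left_unique hr hs hp hp'])

theorem edges_insert_prev_subset (hS : ConvexPartIso r u S) (hu : Aperiodic u)
    (hr : IsTournament r) (hs : IsTournament s) (hq : (q, u v) ∈ S) (hv : v ∉ S.cod) :
    edges u (insert (w, v) S) ⊆ insert (w, q) (edges u S) := by
  rintro ⟨p', q'⟩ hpq
  rcases mem_edges_insert (hu _ 0) hpq with h | ⟨rfl, hq'⟩ | ⟨-, z, rfl, hp'⟩
  · exact Or.inr h
  · exact Or.inl (by rw [hS.left_unique hr hs hq hq'])
  · exact (hS.convex z ⟨p', hp'⟩ hv 1 ⟨q, hq⟩).elim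

theorem edges_insert_offOrbits_subset (hu : Aperiodic u) (hy : OffOrbits u S.cod y) :
    edges u (insert (x, y) S) ⊆ edges u S :=
  edges_insert_subset_of_fresh (hu _ 0) hy.apply_notMem fun z hz => (hy z hz 1).2

theorem exists_insert_offOrbits (hS : ConvexPartIso r u S) (hu : FreelyMoving u)
    (hr : IsTournament r) (hs : IsTournament s) (hx : x ∉ S.dom) :
    ∃ y, OffOrbits u S.cod y ∧ PartIso r s (insert (x, y) S) := by
  obtain ⟨y, hy, -, hoff⟩ := hu.dense _ _ _ (hS.finite_image _) (hS.finite_image _) hS.finite_cod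
    (hS.disjoint_image hr hs (hr.disjoint_out_in x))
  exact ⟨y, hoff, hS.insert_right hr hs hx hy⟩

end ConvexPartIso

section InsertPair

variable {α β : Type*} {r : α → α → Prop} {s : β → β → Prop} {u : s ≃r s} {S : SetRel α β}
  {x x' : α} {y : β}

theorem PartIso.disjoint_pair (hS : PartIso r s S) (hr : IsTournament r) (hs : IsTournament s)
    (hcomp : ∀ a a', (a, a') ∈ edges u S → (r x a ↔ r x' a')) :
    Disjoint (S.image {a | r x a} ∪ u ⁻¹' S.image {a | r x' a})
      (S.image {a | r a x} ∪ u ⁻¹' S.image {a | r a x'}) := by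
  refine .union_left (.union_right ?_ ?_) (.union_right ?_ ?_)
  · exact hS.disjoint_image hr hs (hr.disjoint_out_in x)
  · rw [Set.disjoint_left]
    rintro y ⟨a, ha, hay⟩ ⟨a', ha', hay'⟩
    exact hr.asymm _ _ ((hcomp a a' ⟨y, hay, hay'⟩).1 ha) ha'
  · rw [Set.disjoint_left]
    rintro y ⟨a', ha', hay'⟩ ⟨a, ha, hay⟩
    exact hr.asymm _ _ ((hcomp a a' ⟨y, hay, hay'⟩).2 ha') ha
  · exact (hS.disjoint_image hr hs (hr.disjoint_out_in x')).preimage u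

theorem PartIso.insert_pair (hS : PartIso r s S) (hr : IsTournament r) (hs : IsTournament s)
    (hx : x ∉ S.dom) (hx' : x' ∉ S.dom) (hxx' : r x x') (huy : s y (u y))
    (hy : Realizes s (S.image {a | r x a} ∪ u ⁻¹' S.image {a | r x' a})
      (S.image {a | r a x} ∪ u ⁻¹' S.image {a | r a x'}) y) :
    PartIso r s (insert (x', u y) (insert (x, y) S)) := by
  have hxy : PartIso r s (insert (x, y) S) :=
    hS.insert_right hr hs hx (hy.subset Set.subset_union_left Set.subset_union_left)
  have huy' : Realizes s (S.image {a | r x' a}) (S.image {a | r a x'}) (u y) :=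
    .map u (hy.subset Set.subset_union_right Set.subset_union_right)
  refine hxy.insert_right hr hs ?_ ⟨?_, ?_⟩
  · rw [dom_insert]
    exact not_or.2 ⟨fun h => hr.irrefl x (h ▸ hxx'), hx'⟩
  · rintro b ⟨a, ha, hab | hab⟩
    · obtain ⟨rfl, rfl⟩ := Prod.mk.inj hab
      exact (hr.asymm _ _ hxx' ha).elim
    · exact huy'.1 b ⟨a, ha, hab⟩
  · rintro b ⟨a, ha, hab | hab⟩
    · obtain ⟨rfl, rfl⟩ := Prod.mk.inj hab
      exact huy
    · exact huy'.2 b ⟨a, ha, hab⟩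

theorem ConvexPartIso.exists_insert_pair (hS : ConvexPartIso r u S) (hu : FreelyMoving u)
    (hr : IsTournament r) (hs : IsTournament s) (hx : x ∉ S.dom) (hx' : x' ∉ S.dom)
    (hxx' : r x x') (hcomp : ∀ a a', (a, a') ∈ edges u S → (r x a ↔ r x' a')) :
    ∃ y, ConvexPartIso r u (insert (x', u y) (insert (x, y) S)) ∧
      edges u (insert (x', u y) (insert (x, y) S)) ⊆ insert (x, x') (edges u S) := by
  obtain ⟨y, hy, hsy, hoff⟩ := hu.dense _ _ S.cod
    ((hS.finite_image _).union ((hS.finite_image _).preimage u.injective.injOn))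
    ((hS.finite_image _).union ((hS.finite_image _).preimage u.injective.injOn))
    hS.finite_cod (hS.disjoint_pair hr hs hcomp)
  have hxy : ConvexPartIso r u (insert (x, y) S) :=
    hS.insert_offOrbits hu.aperiodic hoff
      (hS.insert_right hr hs hx (hy.subset Set.subset_union_left Set.subset_union_left))
  have huy : u y ∉ SetRel.cod (insert (x, y) S) := by
    rw [cod_insert]
    exact not_or.2 ⟨hu.aperiodic y 0, hoff.apply_notMem⟩
  refine ⟨y, hxy.insert_next hu.aperiodic ⟨x, .inl rfl⟩ huy
    (hS.insert_pair hr hs hx hx' hxx' hsy hy), ?_⟩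
  exact (hxy.edges_insert_next_subset hu.aperiodic hr hs (.inl rfl) huy).trans
    (Set.insert_subset_insert (edges_insert_offOrbits_subset hu.aperiodic hoff))

end InsertPair

/-! ### Back and forth -/

theorem exists_ideal_meeting_of_countable {P : Type*} [Preorder P] {ι : Type*} [Countable ι] (p : P)
    (D : ι → P → Prop) (hD : ∀ i q, ∃ q' ≥ q, D i q') :
    ∃ I : Order.Ideal P, ∀ i, ∃ q ∈ I, D i q := by
  let _ := Encodable.ofCountable ι
  let cofinal (i : ι) : Order.Cofinal P :=
    ⟨{q | D i q}, fun q => (hD i q).imp fun _ ⟨hle, hq⟩ => ⟨hq, hle⟩⟩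
  exact ⟨Order.idealOfCofinals p cofinal, fun i =>
    (Order.cofinal_meets_idealOfCofinals p cofinal i).imp fun _ ⟨hq, hI⟩ => ⟨hI, hq⟩⟩

section Ideal

variable {α β : Type*} {r : α → α → Prop} {s : β → β → Prop}

theorem PartIso.exists_relIso {S : SetRel α β} (hS : PartIso r s S) (hr : IsTournament r)
    (hs : IsTournament s) (hdom : ∀ x, x ∈ S.dom) (hcod : ∀ y, y ∈ S.cod) :
    ∃ a : r ≃r s, ∀ x y, (x, y) ∈ S → a x = y := by
  choose f hf using hdom
  choose g hg using hcod
  exact ⟨⟨⟨f, g, fun x => hS.left_unique hr hs (hg _) (hf x),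
    fun y => hS.right_unique hr hs (hf _) (hg y)⟩, (hS.rel_iff (hf _) (hf _)).symm⟩,
    fun x _ hxy => hS.right_unique hr hs (hf x) hxy⟩

theorem exists_relIso_of_ideal {P : Type*} [Preorder P] (hr : IsTournament r) (hs : IsTournament s)
    (I : Order.Ideal P) {S : P → SetRel α β} (hmono : Monotone S) (hS : ∀ p, PartIso r s (S p))
    (hdom : ∀ x, ∃ p ∈ I, x ∈ (S p).dom) (hcod : ∀ y, ∃ p ∈ I, y ∈ (S p).cod) :
    ∃ a : r ≃r s, ∀ p ∈ I, ∀ x y, (x, y) ∈ S p → a x = y := by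
  let union : SetRel α β := {xy | ∃ p ∈ I, xy ∈ S p}
  have hunion : PartIso r s union := ⟨fun ⟨p, hp, hxy⟩ ⟨p', hp', hxy'⟩ => by
    obtain ⟨q, -, hpq, hpq'⟩ := I.directed _ hp _ hp'
    exact (hS q).rel_iff (hmono hpq hxy) (hmono hpq' hxy')⟩
  obtain ⟨a, ha⟩ := hunion.exists_relIso hr hs
    (fun x => let ⟨p, hp, y, hxy⟩ := hdom x; ⟨y, p, hp, hxy⟩)
    (fun y => let ⟨p, hp, x, hxy⟩ := hcod y; ⟨x, p, hp, hxy⟩)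
  exact ⟨a, fun p hp x y hxy => ha x y ⟨p, hp, hxy⟩⟩

end Ideal

/-! ### Products of three conjugates -/

section ClosedTriple

variable {T : Type*} {r : T → T → Prop}

/-- Every partial-conjugate edge `h₀ q₂ ↦ q₀` of `S₀` is continued by edges `h₁ q₀ ↦ q₁` of `S₁` and
`h₂ q₁ ↦ q₂` of `S₂`; when all maps are total, the composite of the three conjugates of `u`
interleaved with `h₀`, `h₁`, `h₂` is then the identity. -/
def EdgesClose (u h₀ h₁ h₂ : T → T) (S₀ S₁ S₂ : SetRel T T) : Prop :=
  ∀ q₂ q₀, (h₀ q₂, q₀) ∈ edges u S₀ → ∃ q₁, (h₁ q₀, q₁) ∈ edges u S₁ ∧ (h₂ q₁, q₂) ∈ edges u S₂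

namespace EdgesClose

variable {u h₀ h₁ h₂ : r ≃r r} {S₀ S₁ S₂ S₀' S₁' S₂' : SetRel T T} {q₀ q₁ q₂ a a' : T}

theorem mono (h : EdgesClose u h₀ h₁ h₂ S₀ S₁ S₂) (hS₀ : edges u S₀' ⊆ edges u S₀)
    (hS₁ : S₁ ⊆ S₁') (hS₂ : S₂ ⊆ S₂') : EdgesClose u h₀ h₁ h₂ S₀' S₁' S₂' := fun q₂ q₀ hq => by
  obtain ⟨q₁, hq₁, hq₂⟩ := h q₂ q₀ (hS₀ hq)
  exact ⟨q₁, edges_mono hS₁ hq₁, edges_mono hS₂ hq₂⟩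

theorem extend (h : EdgesClose u h₀ h₁ h₂ S₀ S₁ S₂)
    (hS₀ : edges u S₀' ⊆ insert (h₀ q₂, q₀) (edges u S₀)) (hS₁ : S₁ ⊆ S₁') (hS₂ : S₂ ⊆ S₂')
    (hq₁ : (h₁ q₀, q₁) ∈ edges u S₁') (hq₂ : (h₂ q₁, q₂) ∈ edges u S₂') :
    EdgesClose u h₀ h₁ h₂ S₀' S₁' S₂' := by
  intro p₂ p₀ hp
  rcases hS₀ hp with hnew | hold
  · obtain ⟨hp₂, rfl⟩ := Prod.mk.inj hnew
    obtain rfl := h₀.injective hp₂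
    exact ⟨q₁, hq₁, hq₂⟩
  · exact h.mono subset_rfl hS₁ hS₂ p₂ p₀ hold

theorem rel_iff (h : EdgesClose u h₁ h₂ h₀ S₁ S₂ S₀) (hS₀ : S₀ ⊆ S₀') (hS₂ : S₂ ⊆ S₂')
    (hS₀' : PartIso r r S₀') (hS₂' : PartIso r r S₂') (hq₀ : (h₀ q₂, q₀) ∈ edges u S₀')
    (hq₂ : (h₂ q₁, q₂) ∈ edges u S₂') (ha : (a, a') ∈ edges u S₁) :
    r (h₁ q₀) a ↔ r q₁ a' := by
  obtain ⟨c₀, rfl⟩ := h₁.surjective a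
  obtain ⟨c₂, hc₂, hc₀⟩ := h c₀ a' ha
  calc r (h₁ q₀) (h₁ c₀) ↔ r q₀ c₀ := h₁.map_rel_iff
    _ ↔ r (h₀ q₂) (h₀ c₂) := ((partIso_edges hS₀' u).rel_iff hq₀ (edges_mono hS₀ hc₀)).symm
    _ ↔ r q₂ c₂ := h₀.map_rel_iff
    _ ↔ r (h₂ q₁) (h₂ a') := ((partIso_edges hS₂' u).rel_iff hq₂ (edges_mono hS₂ hc₂)).symm
    _ ↔ r q₁ a' := h₂.map_rel_iff

end EdgesClose

/-- Three finite partial isomorphisms, to be extended to automorphisms `a₀`, `a₁`, `a₂`, all of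
whose edges lie on closed triangles. -/
structure ClosedTriple (u h₀ h₁ h₂ : r ≃r r) where
  /-- The approximation of `a₀`. -/
  S₀ : SetRel T T
  /-- The approximation of `a₁`. -/
  S₁ : SetRel T T
  /-- The approximation of `a₂`. -/
  S₂ : SetRel T T
  conv₀ : ConvexPartIso r u S₀
  conv₁ : ConvexPartIso r u S₁
  conv₂ : ConvexPartIso r u S₂
  close₀ : EdgesClose u h₀ h₁ h₂ S₀ S₁ S₂
  close₁ : EdgesClose u h₁ h₂ h₀ S₁ S₂ S₀
  close₂ : EdgesClose u h₂ h₀ h₁ S₂ S₀ S₁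

namespace ClosedTriple

variable {u h₀ h₁ h₂ : r ≃r r}

instance : Preorder (ClosedTriple u h₀ h₁ h₂) := Preorder.lift fun P => (P.S₀, P.S₁, P.S₂)

/-- The triple without any edges. -/
def empty (u h₀ h₁ h₂ : r ≃r r) : ClosedTriple u h₀ h₁ h₂ where
  S₀ := ∅
  S₁ := ∅
  S₂ := ∅
  conv₀ := .empty
  conv₁ := .empty
  conv₂ := .empty
  close₀ := fun _ _ ⟨_, h, _⟩ => h.elim
  close₁ := fun _ _ ⟨_, h, _⟩ => h.elim
  close₂ := fun _ _ ⟨_, h, _⟩ => h.elim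

/-- The cyclic symmetry of the triangle condition. -/
def rotate (P : ClosedTriple u h₀ h₁ h₂) : ClosedTriple u h₁ h₂ h₀ where
  S₀ := P.S₁
  S₁ := P.S₂
  S₂ := P.S₀
  conv₀ := P.conv₁
  conv₁ := P.conv₂
  conv₂ := P.conv₀
  close₀ := P.close₁
  close₁ := P.close₂
  close₂ := P.close₀

theorem exists_ge_of_rotate {P : ClosedTriple u h₀ h₁ h₂} {Q : ClosedTriple u h₁ h₂ h₀ → Prop}
    (h : ∃ P' ≥ P.rotate, Q P') : ∃ P' ≥ P, Q P'.rotate :=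
  let ⟨P', ⟨hS₁, hS₂, hS₀⟩, hP'⟩ := h
  ⟨P'.rotate.rotate, ⟨hS₀, hS₁, hS₂⟩, hP'⟩

theorem exists_ge_S₀_eq (P : ClosedTriple u h₀ h₁ h₂) {S : SetRel T T} (hS : ConvexPartIso r u S)
    (hle : P.S₀ ⊆ S) (hedges : edges u S ⊆ edges u P.S₀) : ∃ P' ≥ P, P'.S₀ = S :=
  ⟨{ P with
      S₀ := S
      conv₀ := hS
      close₀ := P.close₀.mono hedges subset_rfl subset_rfl
      close₁ := P.close₁.mono subset_rfl subset_rfl hle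
      close₂ := P.close₂.mono subset_rfl hle subset_rfl }, ⟨hle, le_rfl, le_rfl⟩, rfl⟩

theorem exists_ge_mem_dom (P : ClosedTriple u h₀ h₁ h₂) (hu : FreelyMoving u) (hr : IsTournament r)
    (x : T) : ∃ P' ≥ P, x ∈ P'.S₀.dom := by
  by_cases hx : x ∈ P.S₀.dom
  · exact ⟨P, le_rfl, hx⟩
  obtain ⟨y, hoff, hy⟩ := P.conv₀.exists_insert_offOrbits hu hr hr hx
  obtain ⟨P', hP', hS₀⟩ := P.exists_ge_S₀_eq (P.conv₀.insert_offOrbits hu.aperiodic hoff hy)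
    (Set.subset_insert _ _) (ConvexPartIso.edges_insert_offOrbits_subset hu.aperiodic hoff)
  exact ⟨P', hP', y, hS₀ ▸ Set.mem_insert _ _⟩

theorem exists_ge_of_triangle (P : ClosedTriple u h₀ h₁ h₂) {S₀ S₁ S₂ : SetRel T T} {q₀ q₁ q₂ : T}
    (sub₀ : P.S₀ ⊆ S₀) (sub₁ : P.S₁ ⊆ S₁) (sub₂ : P.S₂ ⊆ S₂)
    (conv₀ : ConvexPartIso r u S₀) (conv₁ : ConvexPartIso r u S₁) (conv₂ : ConvexPartIso r u S₂)
    (edge₀ : (h₀ q₂, q₀) ∈ edges u S₀) (edge₁ : (h₁ q₀, q₁) ∈ edges u S₁)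
    (edge₂ : (h₂ q₁, q₂) ∈ edges u S₂)
    (edges₀ : edges u S₀ ⊆ insert (h₀ q₂, q₀) (edges u P.S₀))
    (edges₁ : edges u S₁ ⊆ insert (h₁ q₀, q₁) (edges u P.S₁))
    (edges₂ : edges u S₂ ⊆ insert (h₂ q₁, q₂) (edges u P.S₂)) :
    ∃ P' ≥ P, h₀ q₂ ∈ (edges u P'.S₀).dom :=
  ⟨{ S₀ := S₀
     S₁ := S₁
     S₂ := S₂
     conv₀ := conv₀
     conv₁ := conv₁
     conv₂ := conv₂
     close₀ := P.close₀.extend edges₀ sub₁ sub₂ edge₁ edge₂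
     close₁ := P.close₁.extend edges₁ sub₂ sub₀ edge₂ edge₀
     close₂ := P.close₂.extend edges₂ sub₀ sub₁ edge₀ edge₁ }, ⟨sub₀, sub₁, sub₂⟩, q₀, edge₀⟩

/-- The two ends of the triangle are forced; since the triangles already present make the types of
the remaining two points compatible, an edge of `S₁` can be inserted between them. -/
theorem exists_ge_edge_of_notMem (P : ClosedTriple u h₀ h₁ h₂) (hu : FreelyMoving u)
    (hr : IsRandomTournament r) {q₂ y v : T} (hy : (h₀ q₂, y) ∈ P.S₀) (hv : (q₂, u v) ∈ P.S₂)
    (huy : u y ∉ P.S₀.cod) (hvS₂ : v ∉ P.S₂.cod) :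
    ∃ P' ≥ P, h₀ q₂ ∈ (edges u P'.S₀).dom := by
  have ht := hr.toIsTournament
  obtain ⟨q₀, hq₀, -, hiso₀⟩ := P.conv₀.exists_insert_left hr ht huy
    ((P.conv₁.finite_dom.preimage h₁.injective.injOn).union
      (P.conv₂.finite_dom.preimage (h₂.injective.comp h₁.injective).injOn))
    Set.finite_empty (Set.empty_disjoint _)
  obtain ⟨hq₀S₁, hq₀S₂⟩ := not_or.1 hq₀
  obtain ⟨x, hx, hq₀x, hiso₂⟩ := P.conv₂.exists_insert_left hr ht hvS₂
    (P.conv₁.finite_dom.image h₂) (Set.finite_singleton (h₂ (h₁ q₀)))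
    (Set.disjoint_singleton_left.2 hq₀S₂)
  obtain ⟨q₁, rfl⟩ := h₂.surjective x
  have hrel : r (h₁ q₀) q₁ := h₂.map_rel_iff.1 (hq₀x _ rfl)
  have sub₀ : P.S₀ ⊆ insert (q₀, u y) P.S₀ := Set.subset_insert _ _
  have sub₂ : P.S₂ ⊆ insert (h₂ q₁, v) P.S₂ := Set.subset_insert _ _
  have edge₀ : (h₀ q₂, q₀) ∈ edges u (insert (q₀, u y) P.S₀) := ⟨y, sub₀ hy, .inl rfl⟩
  have edge₂ : (h₂ q₁, q₂) ∈ edges u (insert (h₂ q₁, v) P.S₂) := ⟨v, .inl rfl, sub₂ hv⟩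
  obtain ⟨z, conv₁, edges₁⟩ := P.conv₁.exists_insert_pair hu ht ht hq₀S₁
    (fun hq₁ => hx ⟨q₁, hq₁, rfl⟩) hrel fun a a' =>
      P.close₁.rel_iff sub₀ sub₂ hiso₀.toPartIso hiso₂.toPartIso edge₀ edge₂
  have sub₁ : P.S₁ ⊆ insert (q₁, u z) (insert (h₁ q₀, z) P.S₁) :=
    (Set.subset_insert _ _).trans (Set.subset_insert _ _)
  have edge₁ : (h₁ q₀, q₁) ∈ edges u (insert (q₁, u z) (insert (h₁ q₀, z) P.S₁)) :=
    ⟨z, .inr (.inl rfl), .inl rfl⟩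
  exact P.exists_ge_of_triangle sub₀ sub₁ sub₂
    (P.conv₀.insert_next hu.aperiodic ⟨_, hy⟩ huy hiso₀.toPartIso) conv₁
    (P.conv₂.insert_prev ⟨_, hv⟩ hiso₂.toPartIso) edge₀ edge₁ edge₂
    (P.conv₀.edges_insert_next_subset hu.aperiodic ht ht hy huy) edges₁
    (P.conv₂.edges_insert_prev_subset hu.aperiodic ht ht hv hvS₂)

theorem exists_ge_edge_of_mem (P : ClosedTriple u h₀ h₁ h₂) (hu : FreelyMoving u)
    (hr : IsRandomTournament r) {q₂ y v : T} (hy : (h₀ q₂, y) ∈ P.S₀) (hv : (q₂, u v) ∈ P.S₂) :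
    ∃ P' ≥ P, h₀ q₂ ∈ (edges u P'.S₀).dom := by
  by_cases huy : u y ∈ P.S₀.cod
  · obtain ⟨q₀, hq₀⟩ := huy
    exact ⟨P, le_rfl, q₀, y, hy, hq₀⟩
  by_cases hvS₂ : v ∈ P.S₂.cod
  · obtain ⟨x, hx⟩ := hvS₂
    obtain ⟨q₁, rfl⟩ := h₂.surjective x
    obtain ⟨q₀, hq₀, -⟩ := P.close₂ q₁ q₂ ⟨v, hx, hv⟩
    exact ⟨P, le_rfl, q₀, hq₀⟩
  exact P.exists_ge_edge_of_notMem hu hr hy hv huy hvS₂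

theorem exists_ge_edge_from (P : ClosedTriple u h₀ h₁ h₂) (hu : FreelyMoving u)
    (hr : IsRandomTournament r) (p : T) : ∃ P' ≥ P, p ∈ (edges u P'.S₀).dom := by
  obtain ⟨q₂, rfl⟩ := h₀.surjective p
  obtain ⟨P₁, hP₁, y, hy⟩ := P.exists_ge_mem_dom hu hr.toIsTournament (h₀ q₂)
  obtain ⟨P₂, hP₂, v, hv⟩ := exists_ge_of_rotate <| exists_ge_of_rotate <|
    P₁.rotate.rotate.exists_ge_mem_dom hu hr.toIsTournament q₂
  obtain ⟨v, rfl⟩ := u.surjective v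
  obtain ⟨P₃, hP₃, hp⟩ := P₂.exists_ge_edge_of_mem hu hr (hP₂.1 hy) hv
  exact ⟨P₃, hP₁.trans (hP₂.trans hP₃), hp⟩

theorem exists_ge_edge_to (P : ClosedTriple u h₀ h₁ h₂) (hu : FreelyMoving u)
    (hr : IsRandomTournament r) (q : T) : ∃ P' ≥ P, q ∈ (edges u P'.S₀).cod := by
  obtain ⟨P', hP', q₁, hq₁⟩ := exists_ge_of_rotate (P.rotate.exists_ge_edge_from hu hr (h₁ q))
  obtain ⟨q₂, -, hq₂⟩ := P'.close₁ q q₁ hq₁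
  exact ⟨P', hP', h₀ q₂, hq₂⟩

theorem exists_ge_iterate_mem_cod (P : ClosedTriple u h₀ h₁ h₂) (hu : FreelyMoving u)
    (hr : IsRandomTournament r) {y : T} (hy : y ∈ P.S₀.cod) (n : ℕ) :
    ∃ P' ≥ P, u^[n] y ∈ P'.S₀.cod := by
  induction n with
  | zero => exact ⟨P, le_rfl, hy⟩
  | succ n ih =>
    obtain ⟨P₁, hP₁, x, hx⟩ := ih
    obtain ⟨P₂, hP₂, q, z, hz, hq⟩ := P₁.exists_ge_edge_from hu hr x
    obtain rfl := P₂.conv₀.right_unique hr.toIsTournament hr.toIsTournament (hP₂.1 hx) hz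
    rw [Function.iterate_succ_apply']
    exact ⟨P₂, hP₁.trans hP₂, q, hq⟩

theorem exists_ge_mem_cod_of_iterate (P : ClosedTriple u h₀ h₁ h₂) (hu : FreelyMoving u)
    (hr : IsRandomTournament r) {y : T} {n : ℕ} (hy : u^[n] y ∈ P.S₀.cod) :
    ∃ P' ≥ P, y ∈ P'.S₀.cod := by
  induction n generalizing y with
  | zero => exact ⟨P, le_rfl, hy⟩
  | succ n ih =>
    obtain ⟨P₁, hP₁, x, hx⟩ := ih hy
    obtain ⟨P₂, hP₂, p, z, hp, hz⟩ := P₁.exists_ge_edge_to hu hr x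
    have huz := P₂.conv₀.right_unique hr.toIsTournament hr.toIsTournament hz (hP₂.1 hx)
    obtain rfl := u.injective huz
    exact ⟨P₂, hP₁.trans hP₂, p, hp⟩

theorem exists_ge_mem_cod (P : ClosedTriple u h₀ h₁ h₂) (hu : FreelyMoving u)
    (hr : IsRandomTournament r) (y : T) : ∃ P' ≥ P, y ∈ P'.S₀.cod := by
  by_cases hoff : OffOrbits u P.S₀.cod y
  · obtain ⟨x, -, -, hx⟩ := P.conv₀.exists_insert_left hr hr.toIsTournament hoff.notMem
      Set.finite_empty Set.finite_empty (Set.empty_disjoint _)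
    obtain ⟨P', hP', hS₀⟩ := P.exists_ge_S₀_eq
      (P.conv₀.insert_offOrbits hu.aperiodic hoff hx.toPartIso)
      (Set.subset_insert _ _) (ConvexPartIso.edges_insert_offOrbits_subset hu.aperiodic hoff)
    exact ⟨P', hP', x, hS₀ ▸ Set.mem_insert _ _⟩
  · simp only [OffOrbits, not_forall, not_and_or, not_not] at hoff
    obtain ⟨z, hz, n, rfl | rfl⟩ := hoff
    · exact P.exists_ge_mem_cod_of_iterate hu hr hz
    · exact P.exists_ge_iterate_mem_cod hu hr hz n

/-- `S` has a preimage of `x`, and the edge starting at `x`. -/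
def Covers (u : T → T) (S : SetRel T T) (x : T) : Prop :=
  x ∈ S.cod ∧ x ∈ (edges u S).dom

theorem Covers.mono {u : T → T} {S S' : SetRel T T} {x : T} (h : Covers u S x) (hS : S ⊆ S') :
    Covers u S' x :=
  ⟨SetRel.cod_mono hS h.1, SetRel.dom_mono (edges_mono hS) h.2⟩

theorem Covers.mem_dom {u : T → T} {S : SetRel T T} {x : T} (h : Covers u S x) : x ∈ S.dom :=
  let ⟨_, y, hy, _⟩ := h.2
  ⟨y, hy⟩

theorem exists_ge_covers (P : ClosedTriple u h₀ h₁ h₂) (hu : FreelyMoving u)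
    (hr : IsRandomTournament r) (x : T) : ∃ P' ≥ P, Covers u P'.S₀ x := by
  obtain ⟨P₁, hP₁, hcod⟩ := P.exists_ge_mem_cod hu hr x
  obtain ⟨P₂, hP₂, hedge⟩ := P₁.exists_ge_edge_from hu hr x
  exact ⟨P₂, hP₁.trans hP₂, SetRel.cod_mono hP₂.1 hcod, hedge⟩

theorem exists_ge_covers_all (P : ClosedTriple u h₀ h₁ h₂) (hu : FreelyMoving u)
    (hr : IsRandomTournament r) (x : T) :
    ∃ P' ≥ P, Covers u P'.S₀ x ∧ Covers u P'.S₁ x ∧ Covers u P'.S₂ x := by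
  obtain ⟨P₀, hP₀, h₀⟩ := P.exists_ge_covers hu hr x
  obtain ⟨P₁, hP₁, h₁⟩ := exists_ge_of_rotate (P₀.rotate.exists_ge_covers hu hr x)
  obtain ⟨P₂, hP₂, h₂⟩ := exists_ge_of_rotate <| exists_ge_of_rotate <|
    P₁.rotate.rotate.exists_ge_covers hu hr x
  exact ⟨P₂, hP₀.trans (hP₁.trans hP₂), h₀.mono (hP₁.trans hP₂).1, h₁.mono hP₂.2.1, h₂⟩

end ClosedTriple

open ClosedTriple in
theorem FreelyMoving.exists_conj_mul {u : r ≃r r} (hu : FreelyMoving u)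
    (hr : IsRandomTournament r) (h : r ≃r r) :
    ∃ a b c : r ≃r r, (a⁻¹ * u * a) * (b⁻¹ * u * b) * (c⁻¹ * u * c) = h := by
  have ht := hr.toIsTournament
  have := hr.countable
  obtain ⟨I, hI⟩ := exists_ideal_meeting_of_countable (ClosedTriple.empty u h⁻¹ 1 1) _
    fun (x : T) P => P.exists_ge_covers_all hu hr x
  have limit {S : ClosedTriple u h⁻¹ 1 1 → SetRel T T} (hmono : Monotone S)
      (hiso : ∀ P, PartIso r r (S P)) (hS : ∀ x, ∃ P ∈ I, Covers u (S P) x) :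
      ∃ a : r ≃r r, ∀ P ∈ I, ∀ p q, (p, q) ∈ edges u (S P) → (a⁻¹ * u * a) p = q := by
    obtain ⟨a, ha⟩ := exists_relIso_of_ideal ht ht I hmono hiso
      (fun x => (hS x).imp fun _ hx => ⟨hx.1, hx.2.mem_dom⟩)
      (fun y => (hS y).imp fun _ hy => ⟨hy.1, hy.2.1⟩)
    exact ⟨a, fun P hP _ _ => conj_apply_of_mem_edges (ha P hP)⟩
  obtain ⟨a₀, ha₀⟩ := limit (S := S₀) (fun _ _ hP => hP.1) (fun P => P.conv₀.toPartIso)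
    fun x => (hI x).imp fun _ hx => ⟨hx.1, hx.2.1⟩
  obtain ⟨a₁, ha₁⟩ := limit (S := S₁) (fun _ _ hP => hP.2.1) (fun P => P.conv₁.toPartIso)
    fun x => (hI x).imp fun _ hx => ⟨hx.1, hx.2.2.1⟩
  obtain ⟨a₂, ha₂⟩ := limit (S := S₂) (fun _ _ hP => hP.2.2) (fun P => P.conv₂.toPartIso)
    fun x => (hI x).imp fun _ hx => ⟨hx.1, hx.2.2.2⟩
  refine ⟨a₂, a₁, a₀, RelIso.ext fun x => ?_⟩
  obtain ⟨P, hP, ⟨-, q₀, hq₀⟩, -⟩ := hI x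
  obtain ⟨q₁, hq₁, hq₂⟩ := P.close₀ (h x) q₀ (by rwa [RelIso.inv_apply_self])
  rw [RelIso.mul_apply, RelIso.mul_apply, ha₀ P hP x q₀ hq₀, ha₁ P hP q₀ q₁ hq₁,
    ha₂ P hP q₁ (h x) hq₂]

end ClosedTriple

/-! ### Freely moving products of two conjugates -/

section Step

open Relation

theorem transGen_of_source_sink {T : Type*} {R R' : T → T → Prop} {a b p p' : T}
    (hR : ∀ x x', R' x x' → R x x' ∨ x = a ∨ x' = b) (ha : ∀ x, ¬ R' x a) (hb : ∀ x, ¬ R' b x)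
    (h : TransGen R' p p') (hp : p ≠ a) (hp' : p' ≠ b) : TransGen R p p' := by
  induction h with
  | single h => exact .single ((hR _ _ h).resolve_right (not_or.2 ⟨hp, hp'⟩))
  | @tail c c' hpc hc ih =>
    have hcb : c ≠ b := fun h => hb _ (h ▸ hc)
    have hca : c ≠ a := by
      rintro rfl
      obtain ⟨_, -, h⟩ := TransGen.tail'_iff.1 hpc
      exact ha _ h
    exact (ih hcb).tail ((hR _ _ hc).resolve_right (not_or.2 ⟨hca, hp'⟩))

variable {T : Type*} {r : T → T → Prop}

/-- The pairs `x ↦ x'` forced in `g * (b⁻¹ * g * b)` for every map `b` extending `S`. -/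
def Step (g : T → T) (S : SetRel T T) (x x' : T) : Prop :=
  ∃ z, (x, z) ∈ edges g S ∧ g z = x'

theorem step_mono (g : T → T) : Monotone (Step g) :=
  fun _ _ hS _ _ ⟨z, hz, hx'⟩ => ⟨z, edges_mono hS hz, hx'⟩

theorem Step.mem_dom {g : T → T} {S : SetRel T T} {x x' : T} : Step g S x x' → x ∈ S.dom :=
  fun ⟨_, ⟨y, hy, _⟩, _⟩ => ⟨y, hy⟩

theorem Step.exists_mem_dom {g : T → T} {S : SetRel T T} {x x' : T} :
    Step g S x x' → ∃ z ∈ S.dom, g z = x' :=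
  fun ⟨z, ⟨y, _, hz⟩, hx'⟩ => ⟨z, ⟨g y, hz⟩, hx'⟩

/-- `S'` extends `S` without connecting points of the domain of `S` by new chains of steps. -/
def StepExtends (g : T → T) (S S' : SetRel T T) : Prop :=
  S ⊆ S' ∧ ∀ x ∈ S.dom, ∀ x' ∈ S.dom, ReflTransGen (Step g S') x x' → ReflTransGen (Step g S) x x'

theorem StepExtends.trans {g : T → T} {S S' S'' : SetRel T T} (h : StepExtends g S S')
    (h' : StepExtends g S' S'') : StepExtends g S S'' :=
  ⟨h.1.trans h'.1, fun x hx x' hx' hchain => h.2 x hx x' hx'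
    (h'.2 x (SetRel.dom_mono h.1 hx) x' (SetRel.dom_mono h.1 hx') hchain)⟩

section InsertLeft

variable {g : T → T} {S : SetRel T T} {x d p p' : T}

theorem not_step_insert_to (hg : ∀ a, g a ≠ a) (hprev : ∀ z ∈ S.dom, g z ≠ x) (p : T) :
    ¬ Step g (insert (x, d) S) p x := fun h => by
  obtain ⟨z, hz, hzx⟩ := h.exists_mem_dom
  rw [dom_insert] at hz
  rcases hz with rfl | hz
  exacts [hg z hzx, hprev z hz hzx]

theorem not_step_insert_from (hg : ∀ a, g a ≠ a) (hnext : g x ∉ S.dom) (p : T) :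
    ¬ Step g (insert (x, d) S) (g x) p := fun h => by
  have hdom := h.mem_dom
  rw [dom_insert] at hdom
  exact hdom.elim (hg x) hnext

theorem transGen_step_of_insert (hg : ∀ a, g a ≠ a) (hnext : g x ∉ S.dom)
    (hprev : ∀ z ∈ S.dom, g z ≠ x) (h : TransGen (Step g (insert (x, d) S)) p p') (hp : p ≠ x)
    (hp' : p' ≠ g x) : TransGen (Step g S) p p' := by
  refine transGen_of_source_sink (fun q q' ⟨z, hz, hq'⟩ => ?_) (not_step_insert_to hg hprev)
    (not_step_insert_from hg hnext) h hp hp'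
  rcases mem_edges_insert (hg _) hz with hz | ⟨hq, -⟩ | ⟨rfl, -⟩
  exacts [.inl ⟨z, hz, hq'⟩, .inr (.inl hq), .inr (.inr hq'.symm)]

theorem stepExtends_insert (hg : ∀ a, g a ≠ a) (hx : x ∉ S.dom) (hnext : g x ∉ S.dom)
    (hprev : ∀ z ∈ S.dom, g z ≠ x) : StepExtends g S (insert (x, d) S) := by
  refine ⟨Set.subset_insert _ _, fun p hp p' hp' h => ?_⟩
  rcases reflTransGen_iff_eq_or_transGen.1 h with rfl | h
  · exact .refl
  · exact (transGen_step_of_insert hg hnext hprev h (fun h => hx (h ▸ hp))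
      (fun h => hnext (h ▸ hp'))).to_reflTransGen

theorem acyclic_step_insert (hg : ∀ a, g a ≠ a) (hnext : g x ∉ S.dom)
    (hprev : ∀ z ∈ S.dom, g z ≠ x) (hS : ∀ p, ¬ TransGen (Step g S) p p) (p : T) :
    ¬ TransGen (Step g (insert (x, d) S)) p p := fun h => by
  obtain ⟨_, hout, -⟩ := TransGen.head'_iff.1 h
  obtain ⟨_, -, hin⟩ := TransGen.tail'_iff.1 h
  refine hS p (transGen_step_of_insert hg hnext hprev h ?_ ?_)
  · rintro rfl
    exact not_step_insert_to hg hprev _ hin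
  · rintro rfl
    exact not_step_insert_from hg hnext _ hout

end InsertLeft

/-- A finite partial isomorphism whose steps do not form cycles. -/
structure AcyclicPartIso (g : r ≃r r) where
  /-- The graph of the partial isomorphism. -/
  graph : SetRel T T
  finPartIso : FinPartIso r r graph
  acyclic : ∀ x, ¬ TransGen (Step g graph) x x

namespace AcyclicPartIso

variable {g : r ≃r r}

instance : Preorder (AcyclicPartIso g) where
  le S S' := StepExtends g S.graph S'.graph
  le_refl _ := ⟨le_rfl, fun _ _ _ _ h => h⟩
  le_trans _ _ _ := .trans

theorem graph_mono : Monotone (graph : AcyclicPartIso g → SetRel T T) := fun _ _ h => h.1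

/-- The empty partial isomorphism. -/
def empty (g : r ≃r r) : AcyclicPartIso g where
  graph := ∅
  finPartIso := .empty
  acyclic _ h :=
    let ⟨_, hstep, _⟩ := TransGen.head'_iff.1 h
    let ⟨_, hmem⟩ := hstep.mem_dom
    hmem.elim

theorem exists_insert_left (S : AcyclicPartIso g) (hr : IsRandomTournament r)
    (hg : ∀ a, g a ≠ a) {d : T} (hd : d ∉ S.graph.cod) {C : Set T} (hC : C.Finite)
    (hCS : Disjoint C S.graph.dom) :
    ∃ x, (∀ c ∈ C, r c x) ∧ ∃ S' ≥ S, S'.graph = insert (x, d) S.graph := by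
  have hfin := S.finPartIso.finite_dom
  obtain ⟨x, hx, hCx, hiso⟩ := S.finPartIso.exists_insert_left hr hr.toIsTournament hd
    ((hfin.union (hfin.preimage g.injective.injOn)).union (hfin.image g)) hC hCS
  simp only [Set.mem_union, Set.mem_preimage, Set.mem_image, not_or, not_exists, not_and] at hx
  obtain ⟨⟨hx, hnext⟩, hprev⟩ := hx
  exact ⟨x, hCx, ⟨_, hiso, acyclic_step_insert hg hnext hprev S.acyclic⟩,
    stepExtends_insert hg hx hnext hprev, rfl⟩

theorem exists_insert_right (S : AcyclicPartIso g) (hr : IsRandomTournament r)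
    (hg : ∀ a, g a ≠ a) {x : T} (hx : x ∉ S.graph.dom) :
    ∃ y, g y ∉ insert y S.graph.cod ∧ ∃ S' ≥ S, S'.graph = insert (x, y) S.graph ∧
      Step g S'.graph ≤ Step g S.graph := by
  have hfin := S.finPartIso.finite_cod
  obtain ⟨y, hy, hiso⟩ := S.finPartIso.exists_insert_right hr.toIsTournament hr hx
    ((hfin.preimage g.injective.injOn).union (hfin.image g))
  simp only [Set.mem_union, Set.mem_preimage, Set.mem_image, not_or, not_exists, not_and] at hy
  have hstep : Step g (insert (x, y) S.graph) ≤ Step g S.graph :=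
    fun _ _ ⟨z, hz, hp'⟩ => ⟨z, edges_insert_subset_of_fresh (hg y) hy.1 hy.2 hz, hp'⟩
  exact ⟨y, not_or.2 ⟨hg y, hy.1⟩,
    ⟨_, hiso, fun p h => S.acyclic p (TransGen.mono hstep _ _ h)⟩,
    ⟨Set.subset_insert _ _, fun _ _ _ _ => ReflTransGen.mono hstep _ _⟩, rfl, hstep⟩

theorem exists_ge_mem_dom_cod (S : AcyclicPartIso g) (hr : IsRandomTournament r)
    (hg : ∀ a, g a ≠ a) (x : T) : ∃ S' ≥ S, x ∈ S'.graph.dom ∧ x ∈ S'.graph.cod := by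
  obtain ⟨S', hS', hdom⟩ : ∃ S' ≥ S, x ∈ S'.graph.dom := by
    by_cases hx : x ∈ S.graph.dom
    · exact ⟨S, le_rfl, hx⟩
    · obtain ⟨y, -, S', hS', hgraph, -⟩ := S.exists_insert_right hr hg hx
      exact ⟨S', hS', y, hgraph ▸ Set.mem_insert _ _⟩
  by_cases hx : x ∈ S'.graph.cod
  · exact ⟨S', hS', hdom, hx⟩
  · obtain ⟨d, -, S'', hS'', hgraph⟩ :=
      S'.exists_insert_left hr hg hx Set.finite_empty (Set.empty_disjoint _)
    exact ⟨S'', hS'.trans hS'', SetRel.dom_mono (graph_mono hS'') hdom,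
      d, hgraph ▸ Set.mem_insert _ _⟩

theorem exists_ge_subset_dom_cod (S : AcyclicPartIso g) (hr : IsRandomTournament r)
    (hg : ∀ a, g a ≠ a) {F : Set T} (hF : F.Finite) :
    ∃ S' ≥ S, F ⊆ S'.graph.dom ∧ F ⊆ S'.graph.cod := by
  induction F, hF using Set.Finite.induction_on with
  | empty => exact ⟨S, le_rfl, Set.empty_subset _, Set.empty_subset _⟩
  | insert _ _ ih =>
    obtain ⟨S', hS', hdom, hcod⟩ := ih
    obtain ⟨S'', hS'', hxdom, hxcod⟩ := S'.exists_ge_mem_dom_cod hr hg _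
    have hgraph := graph_mono hS''
    exact ⟨S'', hS'.trans hS'', Set.insert_subset hxdom (hdom.trans (SetRel.dom_mono hgraph)),
      Set.insert_subset hxcod (hcod.trans (SetRel.cod_mono hgraph))⟩

/-- `y` realizes the type given by `A` and `B`, a step leads from `y` along an arrow, and `y` is not
connected to `F` by chains of steps. -/
structure IsGeneric (S : AcyclicPartIso g) (A B F : Set T) (y : T) : Prop where
  realizes : Realizes r A B y
  exists_step : ∃ y', Step g S.graph y y' ∧ r y y'
  not_chain : ∀ f ∈ F, ¬ ReflTransGen (Step g S.graph) y f ∧ ¬ ReflTransGen (Step g S.graph) f y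

theorem exists_ge_isGeneric (S : AcyclicPartIso g) (hr : IsRandomTournament r)
    (hg : ∀ a, g a ≠ a) {A B F : Set T} (hA : A.Finite) (hB : B.Finite) (hAB : Disjoint A B)
    (hF : F ⊆ S.graph.dom) : ∃ S' ≥ S, ∃ y, S'.IsGeneric A B F y := by
  have hfin := S.finPartIso.finite_dom
  obtain ⟨y, hy, hAy⟩ := hr.exists_realizes_notMem hA hB (hfin.union (hfin.image g)) hAB
  obtain ⟨hy, hgy⟩ := not_or.1 hy
  obtain ⟨d, hd, S₁, hS₁, hgraph₁, hstep₁⟩ := S.exists_insert_right hr hg hy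
  have hy₁ : (y, d) ∈ S₁.graph := hgraph₁ ▸ Set.mem_insert _ _
  have hgy₁ : g.symm y ∉ S₁.graph.dom := by
    rw [hgraph₁, dom_insert]
    rintro (h | h)
    exacts [hg y (g.symm_apply_eq.1 h).symm, hgy ⟨_, h, g.apply_symm_apply y⟩]
  obtain ⟨q, hq, S₂, hS₂, hgraph₂⟩ := S₁.exists_insert_left hr hg
    (by rwa [hgraph₁, cod_insert]) (Set.finite_singleton (g.symm y))
    (Set.disjoint_singleton_left.2 hgy₁)
  have hyq : r y (g q) := by simpa using g.map_rel_iff.2 (hq _ rfl)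
  have hstep : Step g S₂.graph y (g q) :=
    ⟨q, ⟨d, graph_mono hS₂ hy₁, hgraph₂ ▸ Set.mem_insert _ _⟩, rfl⟩
  have hF₁ : F ⊆ S₁.graph.dom := hF.trans (SetRel.dom_mono (graph_mono hS₁))
  refine ⟨S₂, hS₁.trans hS₂, y, hAy, ⟨_, hstep, hyq⟩, fun f hf => ⟨fun h => ?_, fun h => ?_⟩⟩
  · rcases (hS₂.2 y ⟨d, hy₁⟩ f (hF₁ hf) h).cases_head with rfl | ⟨c, hc, -⟩
    exacts [hy (hF hf), hy (hstep₁ _ _ hc).mem_dom]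
  · rcases (hS₂.2 f (hF₁ hf) y ⟨d, hy₁⟩ h).cases_tail with rfl | ⟨c, -, hc⟩
    exacts [hy (hF hf), hgy (hstep₁ _ _ hc).exists_mem_dom]

section Ideal

variable {I : Order.Ideal (AcyclicPartIso g)} {u : r ≃r r}

theorem exists_chain_iterate (hu : ∀ x, ∃ S ∈ I, Step g S.graph x (u x)) (n : ℕ) (x : T) :
    ∃ S ∈ I, ReflTransGen (Step g S.graph) x (u^[n] x) := by
  induction n with
  | zero => exact I.nonempty.imp fun _ hS => ⟨hS, .refl⟩
  | succ n ih =>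
    obtain ⟨S₁, hS₁, hchain⟩ := ih
    obtain ⟨S₂, hS₂, hstep⟩ := hu (u^[n] x)
    obtain ⟨S, hS, hle₁, hle₂⟩ := I.directed _ hS₁ _ hS₂
    rw [Function.iterate_succ_apply']
    exact ⟨S, hS, (ReflTransGen.mono (step_mono g (graph_mono hle₁)) _ _ hchain).tail
      (step_mono g (graph_mono hle₂) _ _ hstep)⟩

theorem aperiodic_of_step (hu : ∀ x, ∃ S ∈ I, Step g S.graph x (u x)) : Aperiodic u := by
  intro x n hx
  obtain ⟨S₁, hS₁, hstep⟩ := hu x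
  obtain ⟨S₂, hS₂, hchain⟩ := exists_chain_iterate hu n (u x)
  obtain ⟨S, -, hle₁, hle₂⟩ := I.directed _ hS₁ _ hS₂
  rw [hx] at hchain
  exact S.acyclic x (.head' (step_mono g (graph_mono hle₁) _ _ hstep)
    (ReflTransGen.mono (step_mono g (graph_mono hle₂)) _ _ hchain))

theorem chain_of_iterate_eq (hu : ∀ x, ∃ S ∈ I, Step g S.graph x (u x)) {S : AcyclicPartIso g}
    (hS : S ∈ I) {x x' : T} (hx : x ∈ S.graph.dom) (hx' : x' ∈ S.graph.dom) {n : ℕ}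
    (hn : u^[n] x = x') : ReflTransGen (Step g S.graph) x x' := by
  obtain ⟨S₁, hS₁, hchain⟩ := exists_chain_iterate hu n x
  obtain ⟨S', -, hle, hle₁⟩ := I.directed _ hS _ hS₁
  exact hle.2 x hx x' hx' (hn ▸ ReflTransGen.mono (step_mono g (graph_mono hle₁)) _ _ hchain)

theorem freelyMoving_of_step (hu : ∀ S ∈ I, ∀ x x', Step g S.graph x x' → u x = x')
    (hstep : ∀ x, ∃ S ∈ I, ∃ x', Step g S.graph x x')
    (hgen : ∀ A B F : Set T, A.Finite → B.Finite → F.Finite → Disjoint A B →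
      ∃ S ∈ I, F ⊆ S.graph.dom ∧ ∃ y, S.IsGeneric A B F y) : FreelyMoving u := by
  have hstep_apply (x) : ∃ S ∈ I, Step g S.graph x (u x) := by
    obtain ⟨S, hS, x', hx'⟩ := hstep x
    exact ⟨S, hS, hu S hS x x' hx' ▸ hx'⟩
  refine ⟨aperiodic_of_step hstep_apply, fun A B F hA hB hF hAB => ?_⟩
  obtain ⟨S, hS, hFS, y, hAB, ⟨y', hyy', hry⟩, hFy⟩ := hgen A B F hA hB hF hAB
  exact ⟨y, hAB, hu S hS y y' hyy' ▸ hry, fun f hf n =>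
    ⟨fun h => (hFy f hf).1 (chain_of_iterate_eq hstep_apply hS hyy'.mem_dom (hFS hf) h),
      fun h => (hFy f hf).2 (chain_of_iterate_eq hstep_apply hS (hFS hf) hyy'.mem_dom h)⟩⟩

end Ideal

theorem exists_ideal_generic (g : r ≃r r) (hr : IsRandomTournament r) (hg : ∀ a, g a ≠ a) :
    ∃ I : Order.Ideal (AcyclicPartIso g), ∀ A B F : Set T, A.Finite → B.Finite → F.Finite →
      Disjoint A B → ∃ S ∈ I, F ⊆ S.graph.dom ∧ F ⊆ S.graph.cod ∧ ∃ y, S.IsGeneric A B F y := by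
  have := hr.countable
  obtain ⟨I, hI⟩ := exists_ideal_meeting_of_countable (empty g)
    (fun (X : {X : Finset T × Finset T × Finset T // Disjoint X.1 X.2.1}) S =>
      ↑X.1.2.2 ⊆ S.graph.dom ∧ ↑X.1.2.2 ⊆ S.graph.cod ∧
        ∃ y, S.IsGeneric ↑X.1.1 ↑X.1.2.1 ↑X.1.2.2 y) fun ⟨⟨A, B, F⟩, hAB⟩ S => by
      obtain ⟨S₁, hS₁, hdom, hcod⟩ := S.exists_ge_subset_dom_cod hr hg F.finite_toSet
      obtain ⟨S₂, hS₂, hy⟩ := S₁.exists_ge_isGeneric hr hg A.finite_toSet B.finite_toSet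
        (Finset.disjoint_coe.2 hAB) hdom
      exact ⟨S₂, hS₁.trans hS₂, hdom.trans (SetRel.dom_mono (graph_mono hS₂)),
        hcod.trans (SetRel.cod_mono (graph_mono hS₂)), hy⟩
  refine ⟨I, fun A B F hA hB hF hAB => ?_⟩
  lift A to Finset T using hA
  lift B to Finset T using hB
  lift F to Finset T using hF
  exact hI ⟨⟨A, B, F⟩, Finset.disjoint_coe.1 hAB⟩

end AcyclicPartIso

theorem IsRandomTournament.exists_freelyMoving (hr : IsRandomTournament r) {g : r ≃r r}
    (hg : ∀ a, g a ≠ a) : ∃ b : r ≃r r, FreelyMoving (g * (b⁻¹ * g * b)) := by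
  have ht := hr.toIsTournament
  obtain ⟨I, hI⟩ := AcyclicPartIso.exists_ideal_generic g hr hg
  have hmem (x) : ∃ S ∈ I, x ∈ S.graph.dom ∧ x ∈ S.graph.cod := by
    obtain ⟨S, hS, hdom, hcod, -⟩ :=
      hI ∅ ∅ {x} Set.finite_empty Set.finite_empty (Set.finite_singleton x) (Set.empty_disjoint _)
    exact ⟨S, hS, hdom rfl, hcod rfl⟩
  obtain ⟨b, hb⟩ := exists_relIso_of_ideal ht ht I AcyclicPartIso.graph_mono
    (fun S => S.finPartIso.toPartIso) (fun x => (hmem x).imp fun _ h => ⟨h.1, h.2.1⟩)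
    (fun y => (hmem y).imp fun _ h => ⟨h.1, h.2.2⟩)
  refine ⟨b, AcyclicPartIso.freelyMoving_of_step (I := I) ?_ (fun x => ?_)
    fun A B F hA hB hF hAB => ?_⟩
  · rintro S hS x x' ⟨z, hz, rfl⟩
    exact congrArg g (conj_apply_of_mem_edges (hb S hS) hz)
  · obtain ⟨S₁, hS₁, ⟨y, hy⟩, -⟩ := hmem x
    obtain ⟨S₂, hS₂, -, ⟨q, hq⟩⟩ := hmem (g y)
    obtain ⟨S, hS, hle₁, hle₂⟩ := I.directed _ hS₁ _ hS₂
    exact ⟨S, hS, g q, q, ⟨y, hle₁.1 hy, hle₂.1 hq⟩, rfl⟩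
  · obtain ⟨S, hS, hdom, -, hy⟩ := hI A B F hA hB hF hAB
    exact ⟨S, hS, hdom, hy⟩

theorem IsRandomTournament.isProdOfConjugates_six (hr : IsRandomTournament r) {g : r ≃r r}
    (hg : ∀ a, g a ≠ a) (h : r ≃r r) : IsProdOfConjugates 6 g h := by
  obtain ⟨b, hb⟩ := hr.exists_freelyMoving hg
  obtain ⟨x, y, z, rfl⟩ := hb.exists_conj_mul hr h
  have isConj_conj (f c : r ≃r r) : IsConj f (c⁻¹ * f * c) := isConj_iff.2 ⟨c⁻¹, by rw [inv_inv]⟩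
  have htwo : IsProdOfConjugates 2 g (g * (b⁻¹ * g * b)) :=
    (IsProdOfConjugates.of_isConj (.refl g)).mul (.of_isConj (isConj_conj g b))
  exact ((htwo.congr_isConj (isConj_conj _ x)).mul (htwo.congr_isConj (isConj_conj _ y))).mul
    (htwo.congr_isConj (isConj_conj _ z))

end Step

theorem mainTheorem5_general :
    (∀ {α : Type*} [LinearOrder α], IsDoublyHomogeneous α →
      ∀ g : α ≃o α, UnboundedlyIncreasing g → ∀ h : α ≃o α, IsProdOfConjugates 2 g h) ∧
    (∀ {T : Type*} (r : T → T → Prop), IsRandomTournament r →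
      ∀ g : r ≃r r, (∀ a, g a ≠ a) → ∀ h : r ≃r r, IsProdOfConjugates 6 g h) :=
  ⟨fun hα _ hg h => hg.isProdOfConjugates_two hα h, fun _ hr _ hg h =>
    hr.isProdOfConjugates_six hg h⟩

theorem mainTheorem5 :
    (∀ g : ℚ ≃o ℚ, UnboundedlyIncreasing g → ∀ h : ℚ ≃o ℚ, IsProdOfConjugates 8 g h) ∧
    (∀ {T : Type*} (r : T → T → Prop), IsRandomTournament r →
      ∀ g : r ≃r r, (∀ a, r a (g a)) → ∀ h : r ≃r r, IsProdOfConjugates 8 g h) :=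
  ⟨fun g hg h =>
    (mainTheorem5_general.{0, 0}.1 (isDoublyHomogeneous_of_field ℚ) g hg h).mono (by norm_num),
    fun r hr g hg h => (mainTheorem5_general.{0}.2 r hr g
      (fun a ha => hr.irrefl a (by simpa only [ha] using hg a)) h).mono (by norm_num)⟩
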